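/- **Setting.** Consider a Bayesian Stackelberg Markov game with finite horizon $H$, discount factor $\gamma\in[0,1]$, a finite set $\Xi$ of attacker types, a prior $Q$ on $\Xi$, a state space $S$, a defender's action set $A_{\mathcal D}$, type-dependent attacker action sets $A_\xi$, an initial state law, transition kernels $\mathcal T(\cdot\mid s,a_{\mathcal D},a_{\mathcal A})$ and rewards $r_{\mathcal D}, r_\xi$. The defender plays a Markov policy with density $\pi_{\mathcal D}(a\mid s;\theta)$, differentiable in the parameter $\theta\in\mathbb R^m$, and the type-$\xi$ attacker plays a Markov policy $\pi_\xi(\cdot\mid s;\phi)$, $\phi\in\mathbb R^k$. Let $q(\theta,\phi,\xi)$ be the induced law of the trajectory $(s^t,a^t_{\mathcal D},a^t_{\mathcal A})_{t=1}^H$, and put $$J_{\mathcal D}(\theta,\phi,\xi)=\mathbb E_{q(\theta,\phi,\xi)}\Big[\sum_{t=1}^H\gamma^t r^t_{\mathcal D}\Big],\qquad J_{\mathcal A}(\theta,\phi,\xi)=\mathbb E_{q(\theta,\phi,\xi)}\Big[\sum_{t=1}^H\gamma^t r^t_\xi\Big].$$ For a batch $\tau=(\tau_1,\dots,\tau_N)$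 of $N\ge 1$ independent trajectories from $q(\theta,\phi,\xi)$ let $$\hat\nabla_\theta J_{\mathcal D}(\tau)=\frac1N\sum_{i=1}^N\sum_{t=1}^H\nabla_\theta\log\pi_{\mathcal D}(a^t_{\mathcal D,i}\mid s^t_i;\theta)\,R(\tau_i),\qquad R(\tau_i)=\sum_{t=1}^H\gamma^t r^t_{\mathcal D}(\tau_i),$$ and, for a step size $\eta$, $$\mathcal L_{\mathcal D}(\theta,\phi,\xi)=\mathbb E_{\tau}\,J_{\mathcal D}(\theta+\eta\hat\nabla_\theta J_{\mathcal D}(\tau),\phi,\xi),\qquad \mathcal L_{\mathcal A}(\theta,\phi,\xi)=\mathbb E_{\tau}\,J_{\mathcal A}(\theta+\eta\hat\nabla_\theta J_{\mathcal D}(\tau),\phi,\xi).$$ The defender's meta-objective is $\ell_{\mathcal D}(\theta,(\phi_\xi)_{\xi\in\Xi})=\mathbb E_{\xi\sim Q}\,\mathcal L_{\mathcal D}(\theta,\phi_\xi,\xi)$. Let $\Theta\subset\mathbb R^m$ and $\Phi\subset\mathbb R^k$. A pair $(\theta^*,\{\phi^*_\xi\}_{\xi\in\Xi})\in\Theta\times\Phi^{|\Xi|}$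 is a *meta first-order Stackelberg equilibrium* (meta-FOSE) if $$\max_{\theta\in\Theta,\ \|\theta-\theta^*\|\le 1}\big\langle\nabla_\theta\ell_{\mathcal D}(\theta^*,(\phi^*_\xi)_{\xi}),\,\theta-\theta^*\big\rangle\le 0$$ and, for every $\xi\in\Xi$, $$\max_{\phi\in\Phi,\ \|\phi-\phi^*_\xi\|\le 1}\big\langle\nabla_\phi\mathcal L_{\mathcal A}(\theta^*,\phi^*_\xi,\xi),\,\phi-\phi^*_\xi\big\rangle\le 0 .$$ **Theorem.** Suppose that for every $\xi\in\Xi$ the function $\mathcal L_{\mathcal D}(\cdot,\phi,\xi)$ is differentiable in $\theta$ and $\mathcal L_{\mathcal A}(\theta,\cdot,\xi)$ is differentiable in $\phi$ at all points of $\Theta\times\Phi$, and that the partial gradients $\nabla_\theta\mathcal L_{\mathcal D}(\cdot,\cdot,\xi)$ and $\nabla_\phi\mathcal L_{\mathcal A}(\cdot,\cdot,\xi)$ are continuous on $\Theta\times\Phi$. If $\Theta$ and $\Phi$ are nonempty, compact and convex, then there exists at least one meta-FOSE. -/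

import Mathlib

open MeasureTheory ProbabilityTheory

noncomputable section

namespace MetaStackelberg

/-- A Bayesian Stackelberg Markov game between a defender and an attacker of unknown type `ξ : Ξ`,
together with the players' parametrized Markov policies and the data of the defender's one-step
gradient adaptation.

`S` is the state space, `AD` the defender's action set, `A ξ` the action set of the type-`ξ`
attacker. Defender's parameters are vectors in `ℝᵐ` and attacker's parameters vectors in `ℝᵏ`
(the feasible sets `Θ` and `Φ` are subsets of these spaces; the policies are defined for all
parameters, because the adapted parameter `θ + η • ∇̂J` may leave `Θ`). -/
structure BSMG (S AD : Type*) {Ξ : Type*} (A : Ξ → Type*) (m k : ℕ)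
    [MeasurableSpace S] [MeasurableSpace AD] [∀ ξ, MeasurableSpace (A ξ)] where
  /-- prior distribution over the attack types -/
  prior : PMF Ξ
  /-- law of the first state -/
  initial : Measure S
  initial_prob : IsProbabilityMeasure initial
  /-- the next state given the current state and the joint action -/
  transition : (ξ : Ξ) → Kernel (S × AD × A ξ) S
  transition_markov : ∀ ξ, IsMarkovKernel (transition ξ)
  /-- defender's reward, to be maximized -/
  rewardD : (ξ : Ξ) → S × AD × A ξ → ℝ
  rewardD_measurable : ∀ ξ, Measurable (rewardD ξ)
  /-- type-`ξ` attacker's reward, to be maximized -/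
  rewardA : (ξ : Ξ) → S × AD × A ξ → ℝ
  rewardA_measurable : ∀ ξ, Measurable (rewardA ξ)
  /-- discount factor -/
  discount : ℝ
  discount_mem : discount ∈ Set.Icc (0 : ℝ) 1
  /-- number of rounds -/
  horizon : ℕ
  /-- reference measure for the densities of the defender's policies -/
  reference : Measure AD
  reference_sigmaFinite : SigmaFinite reference
  /-- density `π_D(a | s; θ)` of the defender's Markov policy -/
  densityD : EuclideanSpace ℝ (Fin m) → S → AD → ℝ
  densityD_nonneg : ∀ θ s a, 0 ≤ densityD θ s a
  densityD_measurable : ∀ θ, Measurable (fun p : S × AD => densityD θ p.1 p.2)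
  /-- the policies are differentiable in the parameter, so that `∇_θ log π_D` makes sense -/
  densityD_differentiable : ∀ s a, Differentiable ℝ (fun θ => densityD θ s a)
  densityD_total : ∀ θ s, ∫⁻ a, ENNReal.ofReal (densityD θ s a) ∂reference = 1
  /-- Markov policy `π_ξ(· | s; φ)` of the type-`ξ` attacker -/
  policyA : (ξ : Ξ) → EuclideanSpace ℝ (Fin k) → Kernel S (A ξ)
  policyA_markov : ∀ ξ φ, IsMarkovKernel (policyA ξ φ)
  /-- step size `η` of the gradient adaptation -/
  stepSize : ℝ
  /-- number of sample trajectories used in one gradient estimate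
  (one, for adaptation along a single trajectory) -/
  batchSize : ℕ
  batchSize_pos : 0 < batchSize

namespace BSMG

variable {S AD : Type*} {Ξ : Type*} {A : Ξ → Type*} {m k : ℕ}
  [MeasurableSpace S] [MeasurableSpace AD] [∀ ξ, MeasurableSpace (A ξ)]
  (G : BSMG S AD A m k)

/-- The defender's Markov policy `π_D(· | s; θ)`. -/
def policyD (θ : EuclideanSpace ℝ (Fin m)) : Kernel S AD :=
  haveI := G.reference_sigmaFinite
  Kernel.withDensity (Kernel.const S G.reference) (fun s a => ENNReal.ofReal (G.densityD θ s a))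

/-- The joint law of `(s, a_D, a_A)` given the state `s`: both actions are drawn independently
from the players' policies at `s`. -/
def roundKernel (θ : EuclideanSpace ℝ (Fin m)) (φ : EuclideanSpace ℝ (Fin k)) (ξ : Ξ) :
    Kernel S (S × AD × A ξ) :=
  Kernel.id ×ₖ (G.policyD θ ×ₖ G.policyA ξ φ)

/-- The law of the first `n` rounds `(s, a_D, a_A)`, given the first state. -/
def trajectoryKernel (θ : EuclideanSpace ℝ (Fin m)) (φ : EuclideanSpace ℝ (Fin k)) (ξ : Ξ) :
    (n : ℕ) → Kernel S (Fin n → S × AD × A ξ)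
  | 0 => Kernel.const S (Measure.dirac Fin.elim0)
  | n + 1 =>
    (G.roundKernel θ φ ξ ⊗ₖ
        Kernel.prodMkLeft S (trajectoryKernel θ φ ξ n ∘ₖ G.transition ξ)).map
      (fun p => (Fin.cons p.1 p.2 : Fin (n + 1) → S × AD × A ξ))

/-- The trajectory distribution `q(θ, φ)` under a type-`ξ` attack, over `H` rounds. -/
def trajectoryLaw (θ : EuclideanSpace ℝ (Fin m)) (φ : EuclideanSpace ℝ (Fin k)) (ξ : Ξ) :
    Measure (Fin G.horizon → S × AD × A ξ) :=
  G.initial.bind (G.trajectoryKernel θ φ ξ G.horizon)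

/-- The defender's discounted return `∑_{t=1}^H γ^t r_D^t` along a trajectory. -/
def returnD (ξ : Ξ) (τ : Fin G.horizon → S × AD × A ξ) : ℝ :=
  ∑ t : Fin G.horizon, G.discount ^ ((t : ℕ) + 1) * G.rewardD ξ (τ t)

/-- The attacker's discounted return `∑_{t=1}^H γ^t r_ξ^t` along a trajectory. -/
def returnA (ξ : Ξ) (τ : Fin G.horizon → S × AD × A ξ) : ℝ :=
  ∑ t : Fin G.horizon, G.discount ^ ((t : ℕ) + 1) * G.rewardA ξ (τ t)

/-- `J_D(θ, φ, ξ)`: the defender's expected cumulative reward. -/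
def JD (θ : EuclideanSpace ℝ (Fin m)) (φ : EuclideanSpace ℝ (Fin k)) (ξ : Ξ) : ℝ :=
  ∫ τ, G.returnD ξ τ ∂(G.trajectoryLaw θ φ ξ)

/-- `J_A(θ, φ, ξ)`: the attacker's expected cumulative reward. -/
def JA (θ : EuclideanSpace ℝ (Fin m)) (φ : EuclideanSpace ℝ (Fin k)) (ξ : Ξ) : ℝ :=
  ∫ τ, G.returnA ξ τ ∂(G.trajectoryLaw θ φ ξ)

/-- The policy-gradient sample
`g(τ; θ) = ∑_{t=1}^H ∇_θ log π_D(a_D^t | s^t; θ) R(τ)`, with `R` the defender's return. -/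
def scoreGradient (ξ : Ξ) (θ : EuclideanSpace ℝ (Fin m))
    (τ : Fin G.horizon → S × AD × A ξ) : EuclideanSpace ℝ (Fin m) :=
  ∑ t : Fin G.horizon,
    G.returnD ξ τ •
      gradient (fun θ' => Real.log (G.densityD θ' (τ t).1 (τ t).2.1)) θ

/-- The Monte-Carlo policy-gradient estimate `∇̂_θ J_D(θ, τ)` from a batch of trajectories. -/
def estimatedGradient (ξ : Ξ) (θ : EuclideanSpace ℝ (Fin m))
    (τ : Fin G.batchSize → Fin G.horizon → S × AD × A ξ) : EuclideanSpace ℝ (Fin m) :=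
  (1 / (G.batchSize : ℝ)) • ∑ i, G.scoreGradient ξ θ (τ i)

/-- The defender's parameter after one-step adaptation, `θ + η ∇̂_θ J_D(τ)`. -/
def adapted (ξ : Ξ) (θ : EuclideanSpace ℝ (Fin m))
    (τ : Fin G.batchSize → Fin G.horizon → S × AD × A ξ) : EuclideanSpace ℝ (Fin m) :=
  θ + G.stepSize • G.estimatedGradient ξ θ τ

/-- The law of a batch of independent sample trajectories from `q(θ, φ)`. -/
def batchLaw (θ : EuclideanSpace ℝ (Fin m)) (φ : EuclideanSpace ℝ (Fin k)) (ξ : Ξ) :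
    Measure (Fin G.batchSize → Fin G.horizon → S × AD × A ξ) :=
  Measure.pi (fun _ => G.trajectoryLaw θ φ ξ)

/-- `L_D(θ, φ, ξ) = E_{τ ∼ q(θ, φ)} J_D(θ + η ∇̂_θ J_D(τ), φ, ξ)`. -/
def LD (θ : EuclideanSpace ℝ (Fin m)) (φ : EuclideanSpace ℝ (Fin k)) (ξ : Ξ) : ℝ :=
  ∫ τ, G.JD (G.adapted ξ θ τ) φ ξ ∂(G.batchLaw θ φ ξ)

/-- `L_A(θ, φ, ξ) = E_{τ ∼ q(θ, φ)} J_A(θ + η ∇̂_θ J_D(τ), φ, ξ)`. -/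
def LA (θ : EuclideanSpace ℝ (Fin m)) (φ : EuclideanSpace ℝ (Fin k)) (ξ : Ξ) : ℝ :=
  ∫ τ, G.JA (G.adapted ξ θ τ) φ ξ ∂(G.batchLaw θ φ ξ)

/-- The defender's meta-objective `ℓ_D(θ, (φ_ξ)) = E_{ξ ∼ Q} L_D(θ, φ_ξ, ξ)`. -/
def metaObjective [Fintype Ξ] (θ : EuclideanSpace ℝ (Fin m))
    (φ : Ξ → EuclideanSpace ℝ (Fin k)) : ℝ :=
  ∑ ξ, (G.prior ξ).toReal * G.LD θ (φ ξ) ξ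

/-- The standing smoothness assumption: on `Θ × Φ`, each `L_D(·, ·, ξ)` is continuously
differentiable in `θ` and each `L_A(·, ·, ξ)` is continuously differentiable in `φ`, the partial
gradients being jointly continuous. -/
def IsContinuouslyDifferentiableOn (Θ : Set (EuclideanSpace ℝ (Fin m)))
    (Φ : Set (EuclideanSpace ℝ (Fin k))) : Prop :=
  ∀ ξ : Ξ,
    (∀ θ ∈ Θ, ∀ φ ∈ Φ, DifferentiableAt ℝ (fun θ' => G.LD θ' φ ξ) θ) ∧
    (∀ θ ∈ Θ, ∀ φ ∈ Φ, DifferentiableAt ℝ (fun φ' => G.LA θ φ' ξ) φ) ∧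
    ContinuousOn (fun p : EuclideanSpace ℝ (Fin m) × EuclideanSpace ℝ (Fin k) =>
      gradient (fun θ' => G.LD θ' p.2 ξ) p.1) (Θ ×ˢ Φ) ∧
    ContinuousOn (fun p : EuclideanSpace ℝ (Fin m) × EuclideanSpace ℝ (Fin k) =>
      gradient (fun φ' => G.LA p.1 φ' ξ) p.2) (Θ ×ˢ Φ)

/-- `ε`-meta first-order Stackelberg equilibrium: feasible parameters for which
`max_{θ ∈ Θ, ‖θ - θ*‖ ≤ 1} ⟪∇_θ ℓ_D(θ*, φ*), θ - θ*⟫ ≤ ε` and, for every type `ξ`,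
`max_{φ ∈ Φ, ‖φ - φ*_ξ‖ ≤ 1} ⟪∇_φ L_A(θ*, φ*_ξ, ξ), φ - φ*_ξ⟫ ≤ ε`. -/
structure IsApproxMetaFOSE [Fintype Ξ] (Θ : Set (EuclideanSpace ℝ (Fin m)))
    (Φ : Set (EuclideanSpace ℝ (Fin k))) (ε : ℝ)
    (θ : EuclideanSpace ℝ (Fin m)) (φ : Ξ → EuclideanSpace ℝ (Fin k)) : Prop where
  defender_mem : θ ∈ Θ
  attacker_mem : ∀ ξ, φ ξ ∈ Φ
  defender_le : ∀ θ' ∈ Θ, ‖θ' - θ‖ ≤ 1 →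
    inner ℝ (gradient (fun ϑ => G.metaObjective ϑ φ) θ) (θ' - θ) ≤ ε
  attacker_le : ∀ ξ, ∀ φ' ∈ Φ, ‖φ' - φ ξ‖ ≤ 1 →
    inner ℝ (gradient (fun ψ => G.LA θ ψ ξ) (φ ξ)) (φ' - φ ξ) ≤ ε

/-- Meta first-order Stackelberg equilibrium: the case `ε = 0`. -/
def IsMetaFOSE [Fintype Ξ] (Θ : Set (EuclideanSpace ℝ (Fin m)))
    (Φ : Set (EuclideanSpace ℝ (Fin k)))
    (θ : EuclideanSpace ℝ (Fin m)) (φ : Ξ → EuclideanSpace ℝ (Fin k)) : Prop :=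
  G.IsApproxMetaFOSE Θ Φ 0 θ φ

end BSMG

end MetaStackelberg

end

/-! ### Nearest-point projection onto a closed convex set -/

section Projection

variable {E : Type*} [NormedAddCommGroup E] [InnerProductSpace ℝ E]

/-! A meta-FOSE is a solution of coupled variational inequalities for the continuous fields `∇_θ
ℓ_D` and `∇_φ L_A` on the compact convex set `Θ × Φ^Ξ`; the game enters only through these
gradients. With `P` the nearest-point projection, `P (x + u x) = x` says exactly that `⟪u x, x' - x⟫
≤ 0` for all feasible `x'`, so equilibria are fixed points of a projected gradient step
(`exists_coupled_variational_solution`), and Brouwer's theorem supplies one.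

Brouwer's theorem (`exists_fixedPoint_of_bounded`) is reduced by smoothing to
`not_exists_contDiff_retraction_sphere`, which is proved by a volume computation in the manner of
Milnor and Rogers. -/

theorem exists_convex_projection [CompleteSpace E] {K : Set E} (hne : K.Nonempty)
    (hclosed : IsClosed K) (hconv : Convex ℝ K) :
    ∃ P : E → E, ∀ u, P u ∈ K ∧ ∀ w ∈ K, inner ℝ (u - P u) (w - P u) ≤ 0 := by
  choose P hP hmin using exists_norm_eq_iInf_of_complete_convex hne hclosed.isComplete hconv
  exact ⟨P, fun u => ⟨hP u, (norm_eq_iInf_iff_real_inner_le_zero hconv (hP u)).1 (hmin u)⟩⟩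

theorem lipschitzWith_convex_projection {K : Set E} {P : E → E}
    (hP : ∀ u, P u ∈ K ∧ ∀ w ∈ K, inner ℝ (u - P u) (w - P u) ≤ 0) : LipschitzWith 1 P := by
  refine LipschitzWith.of_dist_le_mul fun u v => ?_
  rw [NNReal.coe_one, one_mul, dist_eq_norm, dist_eq_norm]
  have h1 := (hP u).2 (P v) (hP v).1
  have h2 := (hP v).2 (P u) (hP u).1
  -- Sum of the two obtuse-angle inequalities; Cauchy–Schwarz then finishes.
  have key : ‖P u - P v‖ * ‖P u - P v‖ ≤ inner ℝ (u - v) (P u - P v) := by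
    rw [← real_inner_self_eq_norm_mul_norm]
    simp only [inner_sub_left, inner_sub_right] at h1 h2 ⊢
    linarith
  have hcs := real_inner_le_norm (u - v) (P u - P v)
  by_contra! hlt
  have hpos : 0 < ‖P u - P v‖ := (norm_nonneg _).trans_lt hlt
  nlinarith

theorem convex_projection_eq_self {K : Set E} {P : E → E}
    (hP : ∀ u, P u ∈ K ∧ ∀ w ∈ K, inner ℝ (u - P u) (w - P u) ≤ 0) {u : E} (hu : u ∈ K) :
    P u = u := by
  have h := (hP u).2 u hu
  rw [real_inner_self_nonpos, sub_eq_zero] at h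
  exact h.symm

theorem norm_convex_projection_closedBall {R : ℝ} (hR : 0 ≤ R) {P : E → E}
    (hP : ∀ u, P u ∈ Metric.closedBall (0 : E) R ∧
      ∀ w ∈ Metric.closedBall (0 : E) R, inner ℝ (u - P u) (w - P u) ≤ 0)
    {u : E} (hu : u ∉ Metric.closedBall (0 : E) R) : ‖P u‖ = R := by
  have hmem := (hP u).1
  have hne : u - P u ≠ 0 := fun h => hu (by rw [sub_eq_zero.1 h]; exact hmem)
  have hpos : 0 < ‖u - P u‖ := norm_pos_iff.2 hne
  refine le_antisymm (by simpa using hmem) ?_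
  -- Test point: where the ball extends furthest in the direction `u - P u`. It yields `R * ‖u - P
  -- u‖ ≤ ⟪u - P u, P u⟫`.
  have h := (hP u).2 ((R / ‖u - P u‖) • (u - P u)) (by
    rw [mem_closedBall_zero_iff, norm_smul, Real.norm_of_nonneg (by positivity),
      div_mul_cancel₀ _ hpos.ne'])
  rw [inner_sub_right, real_inner_smul_right, real_inner_self_eq_norm_mul_norm] at h
  have hcs := real_inner_le_norm (u - P u) (P u)
  have hdiv : R / ‖u - P u‖ * (‖u - P u‖ * ‖u - P u‖) = R * ‖u - P u‖ := by
    field_simp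
  nlinarith

end Projection

/-! ### The determinant of `1 + t • A` -/

section Det

variable {E : Type*} [NormedAddCommGroup E] [NormedSpace ℝ E] [FiniteDimensional ℝ E]

theorem exists_polynomial_det_one_add_smul (A : E →L[ℝ] E) :
    ∃ p : Polynomial ℝ, p.degree < (Module.finrank ℝ E + 1 : ℕ) ∧
      ∀ t : ℝ, p.eval t = (1 + t • A).det := by
  let b := Module.finBasis ℝ E
  let M := LinearMap.toMatrix b b (A : E →ₗ[ℝ] E)
  refine ⟨((Polynomial.X : Polynomial ℝ) • M.map Polynomial.C +
    (1 : Matrix _ _ ℝ).map Polynomial.C).det, ?_, fun t => ?_⟩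
  · refine (Polynomial.degree_le_natDegree).trans_lt ?_
    have := Polynomial.natDegree_det_X_add_C_le M 1
    rw [Fintype.card_fin] at this
    exact_mod_cast Nat.lt_succ_of_le this
  · have hdet : (1 + t • A).det = LinearMap.det ((1 + t • A : E →L[ℝ] E) : E →ₗ[ℝ] E) := rfl
    have hM : LinearMap.toMatrix b b ((1 + t • A : E →L[ℝ] E) : E →ₗ[ℝ] E) = 1 + t • M := by
      rw [← LinearMap.toMatrix_one b]
      simp only [M, ← map_smul, ← map_add]
      rfl
    rw [hdet, ← LinearMap.det_toMatrix b, hM, ← Polynomial.coe_evalRingHom,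
      RingHom.map_det]
    congr 1
    ext i j
    by_cases hij : i = j <;> simp [hij] <;> ring

/-- Along the segment `1 + s • A` the operator stays injective, so its determinant cannot change
sign from its value `1` at `s = 0`. -/
theorem det_one_add_pos {A : E →L[ℝ] E} (hA : ‖A‖ < 1) : 0 < (1 + A).det := by
  have hcont : Continuous fun s : ℝ => (1 + s • A).det := by
    exact ContinuousLinearMap.continuous_det.comp (by fun_prop)
  have hne : ∀ s ∈ Set.Icc (0 : ℝ) 1, (1 + s • A).det ≠ 0 := by
    intro s hs h0
    have hker : LinearMap.ker ((1 + s • A : E →L[ℝ] E) : E →ₗ[ℝ] E) ≠ ⊥ :=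
      (LinearMap.bot_lt_ker_of_det_eq_zero h0).ne'
    obtain ⟨v, hv, hv0⟩ := Submodule.exists_mem_ne_zero_of_ne_bot hker
    have hv' : v + s • A v = 0 := by simpa using hv
    have hnorm : ‖v‖ = s * ‖A v‖ := by
      have h := congrArg norm (eq_neg_of_add_eq_zero_left hv')
      rwa [norm_neg, norm_smul, Real.norm_of_nonneg hs.1] at h
    have hle := A.le_opNorm v
    have hvpos : 0 < ‖v‖ := norm_pos_iff.2 hv0
    have h1 : s * ‖A v‖ ≤ ‖A v‖ := mul_le_of_le_one_left (norm_nonneg _) hs.2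
    nlinarith
  by_contra! hle
  have hone : (1 + (1 : ℝ) • A).det ≤ 0 := by simpa using hle
  have hzero : 0 ≤ (1 + (0 : ℝ) • A).det := by
    rw [zero_smul, add_zero]
    change 0 ≤ LinearMap.det (LinearMap.id : E →ₗ[ℝ] E)
    simp
  obtain ⟨s, hs, hs0⟩ := intermediate_value_Icc' zero_le_one hcont.continuousOn ⟨hone, hzero⟩
  exact hne s hs hs0

end Det

/-! ### Absence of smooth retractions onto a sphere -/

section Retraction

variable {E : Type*} [NormedAddCommGroup E] [InnerProductSpace ℝ E] [FiniteDimensional ℝ E]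

/-- A Lipschitz displacement which vanishes on the boundary sphere gives, after scaling,
a bijection of the closed ball. -/
theorem image_closedBall_eq_of_contracting_displacement {R : ℝ} (hR : 0 ≤ R) {g : E → E}
    {c : NNReal} (hc : c < 1) (hg : LipschitzOnWith c g (Metric.closedBall 0 R))
    (hzero : ∀ x, ‖x‖ = R → g x = 0)
    (hmaps : ∀ x ∈ Metric.closedBall (0 : E) R, x + g x ∈ Metric.closedBall (0 : E) R) :
    Set.InjOn (fun x => x + g x) (Metric.closedBall 0 R) ∧
      (fun x => x + g x) '' Metric.closedBall 0 R = Metric.closedBall 0 R := by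
  obtain ⟨P, hP⟩ := exists_convex_projection (E := E) (K := Metric.closedBall 0 R)
    ⟨0, by simpa using hR⟩ Metric.isClosed_closedBall (convex_closedBall _ _)
  -- Precomposing with `P` extends the displacement to all of `E` with the same constant, so `x + g
  -- (P x)` is a bijection of `E`. Outside the ball `P x` lies on the sphere and the map is the
  -- identity, so preimages of points of the ball lie in the ball.
  have hlip : LipschitzWith c (g ∘ P) := by
    have h := hg.comp (lipschitzWith_convex_projection hP).lipschitzOnWith
      (s := Set.univ) (fun u _ => (hP u).1)
    rwa [mul_one, lipschitzOnWith_univ] at h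
  have happrox : ApproximatesLinearOn (fun x => x + g (P x))
      ((ContinuousLinearEquiv.refl ℝ E : E ≃L[ℝ] E) : E →L[ℝ] E) Set.univ c := by
    intro x _ y _
    have h := hlip.dist_le_mul x y
    rw [dist_eq_norm, dist_eq_norm] at h
    have heq : x + g (P x) - (y + g (P y)) - (x - y) = g (P x) - g (P y) := by abel
    change ‖x + g (P x) - (y + g (P y)) - (x - y)‖ ≤ c * ‖x - y‖
    rw [heq]
    exact h
  -- The identity has norm `1` only on a nontrivial space.
  have hcN : Subsingleton E ∨
      c < ‖((ContinuousLinearEquiv.refl ℝ E).symm : E →L[ℝ] E)‖₊⁻¹ := by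
    rcases subsingleton_or_nontrivial E with h | h
    · exact Or.inl h
    · right
      simpa using hc
  have hin : ∀ x ∈ Metric.closedBall (0 : E) R, P x = x :=
    fun x hx => convex_projection_eq_self hP hx
  refine ⟨fun x hx y hy hxy => ?_, Set.Subset.antisymm ?_ ?_⟩
  · refine happrox.injOn hcN (Set.mem_univ x) (Set.mem_univ y) ?_
    simpa only [hin x hx, hin y hy] using hxy
  · rintro _ ⟨x, hx, rfl⟩
    exact hmaps x hx
  · intro y hy
    obtain ⟨x, hx⟩ := happrox.surjective hcN y
    change x + g (P x) = y at hx
    by_cases hxB : x ∈ Metric.closedBall (0 : E) R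
    · exact ⟨x, hxB, by simpa only [hin x hxB] using hx⟩
    · rw [hzero _ (norm_convex_projection_closedBall hR hP hxB), add_zero] at hx
      exact absurd (hx ▸ hy) hxB

/-- For small `t` the map `x + t • (r x - x)` is a bijection of the ball, so its Jacobian
determinant integrates to the volume of the ball. This integral is polynomial in `t`, hence keeps
that value at `t = 1`, where the map is `r` and the Jacobian vanishes identically. -/
theorem not_exists_contDiff_retraction_sphere {R : ℝ} (hR : 0 < R) {r : E → E}
    (hr : ContDiff ℝ 1 r) (hnorm : ∀ x, ‖r x‖ = R) (hfix : ∀ x, ‖x‖ = R → r x = x) : False := by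
  let : MeasurableSpace E := borel E
  have : BorelSpace E := ⟨rfl⟩
  let B : Set E := Metric.closedBall 0 R
  have hBcompact : IsCompact B := isCompact_closedBall _ _
  have hBmeas : MeasurableSet B := Metric.isClosed_closedBall.measurableSet
  let g : E → E := fun x => r x - x
  have hg : ContDiff ℝ 1 g := hr.sub contDiff_id
  have hgdiff : Differentiable ℝ g := hg.differentiable one_ne_zero
  have hDg : Continuous (fderiv ℝ g) := hg.continuous_fderiv one_ne_zero
  obtain ⟨C₀, hC₀⟩ := hBcompact.exists_bound_of_continuousOn hDg.continuousOn
  let C : NNReal := C₀.toNNReal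
  have hC : ∀ x ∈ B, ‖fderiv ℝ g x‖₊ ≤ C := fun x hx => by
    rw [← NNReal.coe_le_coe, coe_nnnorm]
    exact (hC₀ x hx).trans (Real.le_coe_toNNReal _)
  have hlip : LipschitzOnWith C g B :=
    (convex_closedBall (0 : E) R).lipschitzOnWith_of_nnnorm_fderiv_le
      (fun x _ => hgdiff x) hC
  -- The bound with `C + 1` gives both `t ≤ 1`, for convexity of the ball, and `t * C < 1`, for
  -- contraction, even when `C = 0`.
  have hvolume : ∀ t : NNReal, t * (C + 1) ≤ 1 →
      ∫ x in B, (1 + (t : ℝ) • fderiv ℝ g x).det = (volume : Measure E).real B := by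
    intro t ht
    have ht1 : (t : ℝ) ≤ 1 := by
      have : t ≤ 1 := le_trans (le_mul_of_one_le_right zero_le (by simp)) ht
      exact_mod_cast this
    have htC : t * C < 1 := by
      rcases eq_or_ne t 0 with rfl | h0
      · simp
      · refine lt_of_lt_of_le ?_ ht
        exact mul_lt_mul_of_pos_left (by simp) (pos_iff_ne_zero.2 h0)
    have hlipt : LipschitzOnWith (t * C) (fun x => (t : ℝ) • g x) B := by
      refine LipschitzOnWith.of_dist_le_mul fun x hx y hy => ?_
      rw [dist_smul₀, Real.norm_of_nonneg t.coe_nonneg, NNReal.coe_mul, mul_assoc]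
      exact mul_le_mul_of_nonneg_left (hlip.dist_le_mul x hx y hy) t.2
    obtain ⟨hinj, himage⟩ := image_closedBall_eq_of_contracting_displacement hR.le htC hlipt
      (fun x hx => by simp [g, hfix x hx]) (fun x hx => by
        have h := convex_closedBall (0 : E) R hx
          (show r x ∈ Metric.closedBall (0 : E) R by simp [hnorm x])
          (sub_nonneg.2 ht1) t.2 (sub_add_cancel _ _)
        convert h using 1
        simp only [g, smul_sub, sub_smul, one_smul]
        change x + ((t : ℝ) • r x - (t : ℝ) • x) = x - (t : ℝ) • x + (t : ℝ) • r x
        abel)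
    have hchange := integral_image_eq_integral_abs_det_fderiv_smul (volume : Measure E) hBmeas
      (f := fun x => x + (t : ℝ) • g x) (f' := fun x => 1 + (t : ℝ) • fderiv ℝ g x)
      (fun x _ => ((hasFDerivAt_id x).add
        ((hgdiff x).hasFDerivAt.const_smul (t : ℝ))).hasFDerivWithinAt) hinj (fun _ => (1 : ℝ))
    rw [himage] at hchange
    rw [setIntegral_const, smul_eq_mul, mul_one] at hchange
    rw [hchange]
    refine setIntegral_congr_fun hBmeas fun x hx => ?_
    have hpos : 0 < (1 + (t : ℝ) • fderiv ℝ g x).det := det_one_add_pos (by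
      rw [norm_smul, Real.norm_of_nonneg t.coe_nonneg]
      have h := mul_le_mul_of_nonneg_left (hC x hx) (zero_le (a := t))
      exact lt_of_le_of_lt (by exact_mod_cast h) (by exact_mod_cast htC))
    simp [abs_of_pos hpos]
  let d := Module.finrank ℝ E + 1
  let s : Finset ℕ := Finset.range d
  -- These are `dim E + 1` distinct admissible times, enough to determine a polynomial of degree at
  -- most `dim E`. The Lagrange weights `L i` at `1` do not depend on `x`, so interpolation commutes
  -- with the integral.
  let node : ℕ → NNReal := fun i => (i + 1) / (d * (C + 1))
  have hd : (0 : NNReal) < d := by exact_mod_cast Nat.succ_pos _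
  have hnode : ∀ i ∈ s, node i * (C + 1) ≤ 1 := by
    intro i hi
    have hi' : ((i : NNReal) + 1) ≤ d := by exact_mod_cast Finset.mem_range.1 hi
    have : node i * (C + 1) = (i + 1) / d := by
      have : C + 1 ≠ 0 := by positivity
      simp only [node]
      field_simp
    rw [this]
    exact div_le_one_of_le₀ hi' zero_le
  have hnode_inj : Set.InjOn (fun i => (node i : ℝ)) s := by
    intro i _ j _ hij
    have hij' : node i = node j := NNReal.coe_injective hij
    have hden : (d : NNReal) * (C + 1) ≠ 0 := by positivity
    simp only [node] at hij'
    rw [div_left_inj' hden] at hij'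
    exact_mod_cast add_right_cancel hij'
  let L : ℕ → ℝ := fun i => (Lagrange.basis s (fun i => (node i : ℝ)) i).eval 1
  have hLsum : ∑ i ∈ s, L i = 1 := by
    have h := congrArg (Polynomial.eval 1) (Lagrange.sum_basis hnode_inj ⟨0, by simp [s, d]⟩)
    simpa [Polynomial.eval_finsetSum] using h
  have hinterp : ∀ x, (1 + fderiv ℝ g x).det =
      ∑ i ∈ s, L i * (1 + (node i : ℝ) • fderiv ℝ g x).det := by
    intro x
    obtain ⟨p, hdeg, hp⟩ := exists_polynomial_det_one_add_smul (fderiv ℝ g x)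
    have h := congrArg (Polynomial.eval 1)
      (Lagrange.eq_interpolate hnode_inj (f := p) (by simpa [s, d] using hdeg))
    rw [Lagrange.interpolate_apply, Polynomial.eval_finsetSum, hp, one_smul] at h
    rw [h]
    refine Finset.sum_congr rfl fun i _ => ?_
    rw [Polynomial.eval_mul, Polynomial.eval_C, hp, mul_comm]
  have hsingular : ∀ x, (1 + fderiv ℝ g x).det = 0 := by
    intro x
    have hrx : HasFDerivAt r (fderiv ℝ r x) x := (hr.differentiable one_ne_zero x).hasFDerivAt
    have heq : 1 + fderiv ℝ g x = fderiv ℝ r x := by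
      have : fderiv ℝ g x = fderiv ℝ r x - 1 := (hrx.sub (hasFDerivAt_id x)).fderiv
      rw [this, add_sub_cancel]
    rw [heq]
    -- Since `‖r‖` is constant, the derivative has range orthogonal to `r x ≠ 0` and is not
    -- surjective.
    have horth : ∀ v, inner ℝ (r x) (fderiv ℝ r x v) = 0 := by
      intro v
      have h1 := (hrx.inner ℝ hrx)
      have h2 : (fun y => inner ℝ (r y) (r y)) = fun _ => R * R := by
        funext y
        rw [real_inner_self_eq_norm_mul_norm, hnorm]
      rw [h2] at h1
      have h3 := congrArg (fun T => T v) (h1.unique (hasFDerivAt_const (R * R) x))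
      simp [real_inner_comm] at h3
      linarith
    by_contra hne
    have hunit : IsUnit ((fderiv ℝ r x : E →L[ℝ] E) : E →ₗ[ℝ] E) :=
      (LinearMap.isUnit_iff_isUnit_det _).2 (isUnit_iff_ne_zero.2 hne)
    obtain ⟨v, hv⟩ := ((Module.End.isUnit_iff _).1 hunit).2 (r x)
    have h := horth v
    have hv' : fderiv ℝ r x v = r x := hv
    rw [hv', real_inner_self_eq_norm_mul_norm, hnorm] at h
    nlinarith
  have hint : ∀ i ∈ s, Integrable (fun x => L i * (1 + (node i : ℝ) • fderiv ℝ g x).det)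
      (volume.restrict B) := by
    intro i _
    have hcont : Continuous fun x => L i * (1 + (node i : ℝ) • fderiv ℝ g x).det :=
      continuous_const.mul (ContinuousLinearMap.continuous_det.comp (by fun_prop))
    exact hcont.continuousOn.integrableOn_compact hBcompact
  have hvol : (volume : Measure E).real B = 0 := by
    calc (volume : Measure E).real B
        = ∑ i ∈ s, L i * (volume : Measure E).real B := by
          rw [← Finset.sum_mul, hLsum, one_mul]
      _ = ∑ i ∈ s, ∫ x in B, L i * (1 + (node i : ℝ) • fderiv ℝ g x).det := by
          refine Finset.sum_congr rfl fun i hi => ?_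
          rw [integral_const_mul, hvolume _ (hnode i hi)]
      _ = ∫ x in B, (1 + fderiv ℝ g x).det := by
          rw [← integral_finsetSum _ hint]
          simp only [hinterp]
      _ = 0 := by simp [hsingular]
  have hpos : 0 < (volume : Measure E).real B :=
    ENNReal.toReal_pos (Metric.measure_closedBall_pos _ _ hR).ne' hBcompact.measure_lt_top.ne
  exact hpos.ne' hvol

end Retraction

/-! ### Fixed points of bounded continuous maps -/

section FixedPoint

/-- A `C¹` map which vanishes on some sphere around the origin has a fixed point. -/
theorem exists_fixedPoint_of_contDiff_of_eq_zero_on_sphere {E : Type*}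
    [NormedAddCommGroup E] [InnerProductSpace ℝ E] [FiniteDimensional ℝ E] {g : E → E} (hg : ContDiff ℝ 1 g) {R : ℝ}
    (hR : 0 < R) (hzero : ∀ x, ‖x‖ = R → g x = 0) : ∃ x, g x = x := by
  by_contra! hne
  have hh : ∀ x, x - g x ≠ 0 := fun x h => hne x (sub_eq_zero.1 h).symm
  have hdiff : ContDiff ℝ 1 fun x => x - g x := contDiff_id.sub hg
  -- Without fixed points, `x - g x` can be normalised to length `R`; where `g` vanishes on the
  -- sphere this is `x` itself.
  refine not_exists_contDiff_retraction_sphere hR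
    (r := fun x => (R / ‖x - g x‖) • (x - g x)) ?_ (fun x => ?_) (fun x hx => ?_)
  · exact (contDiff_const.div (hdiff.norm ℝ hh) fun x => norm_ne_zero_iff.2 (hh x)).smul hdiff
  · have := norm_pos_iff.2 (hh x)
    rw [norm_smul, Real.norm_of_nonneg (by positivity), div_mul_cancel₀ _ this.ne']
  · rw [hzero x hx, sub_zero, hx, div_self hR.ne', one_smul]

/-- Smooth approximations of `f`, cut off far out, have fixed points in a common ball; these are
almost fixed by `f`, so the minimum of `‖f x - x‖` over that compact ball is zero. -/
theorem exists_fixedPoint_of_bounded_of_innerProductSpace {E : Type*} [NormedAddCommGroup E]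
    [InnerProductSpace ℝ E] [FiniteDimensional ℝ E] {f : E → E} (hf : Continuous f)
    (hbdd : Bornology.IsBounded (Set.range f)) : ∃ x, f x = x := by
  obtain ⟨C, hCpos, hC⟩ := hbdd.exists_pos_norm_le
  have hC' : ∀ x, ‖f x‖ ≤ C := fun x => hC _ ⟨x, rfl⟩
  have happrox : ∀ ε : ℝ, 0 < ε → ε ≤ 1 →
      ∃ x ∈ Metric.closedBall (0 : E) (C + 1), ‖f x - x‖ < ε := by
    intro ε hε hε1
    obtain ⟨g, hg, hgf, -⟩ := hf.exists_contDiff_approx 1 (continuous_const (y := ε)) fun _ => hε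
    have hgC : ∀ x, ‖g x‖ ≤ C + 1 := by
      intro x
      have h1 := hgf x
      rw [dist_eq_norm, norm_sub_rev] at h1
      have h2 := norm_le_norm_add_norm_sub (f x) (g x)
      have h3 := hC' x
      linarith
    -- As `‖g‖ ≤ C + 1` and `χ ≤ 1`, a fixed point of `χ • g` lies where `χ = 1`, so it is fixed by
    -- `g`.
    let χ : ContDiffBump (0 : E) := ⟨C + 1, C + 2, by positivity, by linarith⟩
    obtain ⟨x, hx⟩ := exists_fixedPoint_of_contDiff_of_eq_zero_on_sphere
      (g := fun x => χ x • g x)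
      (χ.contDiff.smul hg) (R := C + 2) (by positivity) (fun x hx => by
        rw [χ.zero_of_le_dist (by simp [χ, hx]), zero_smul])
    have hxC : ‖x‖ ≤ C + 1 := by
      rw [← hx, norm_smul, Real.norm_of_nonneg χ.nonneg]
      exact (mul_le_of_le_one_left (norm_nonneg _) χ.le_one).trans (hgC x)
    have hxB : x ∈ Metric.closedBall (0 : E) (C + 1) := by simpa using hxC
    simp only [χ.one_of_mem_closedBall hxB, one_smul] at hx
    refine ⟨x, hxB, ?_⟩
    have h := hgf x
    rwa [hx, dist_comm, dist_eq_norm] at h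
  obtain ⟨x, -, hx⟩ := (isCompact_closedBall (0 : E) (C + 1)).exists_isMinOn
    ⟨0, by simp; positivity⟩ (f := fun x => ‖f x - x‖)
    (hf.sub continuous_id).norm.continuousOn
  refine ⟨x, ?_⟩
  by_contra hne
  have hpos : 0 < ‖f x - x‖ := norm_pos_iff.2 (sub_ne_zero.2 hne)
  obtain ⟨y, hy, hyε⟩ := happrox (min ‖f x - x‖ 1) (lt_min hpos one_pos) (min_le_right _ _)
  exact absurd (hx hy) (not_le.2 (hyε.trans_le (min_le_left _ _)))

/-- Brouwer's fixed point theorem, for continuous self-maps of a finite-dimensional space with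
bounded range. -/
theorem exists_fixedPoint_of_bounded {E : Type*} [NormedAddCommGroup E] [NormedSpace ℝ E]
    [FiniteDimensional ℝ E] {f : E → E} (hf : Continuous f)
    (hbdd : Bornology.IsBounded (Set.range f)) : ∃ x, f x = x := by
  -- Transport removes the need for an inner product, which matters for products with their sup
  -- norm.
  let e : E ≃L[ℝ] EuclideanSpace ℝ (Fin (Module.finrank ℝ E)) := toEuclidean
  obtain ⟨x, hx⟩ := exists_fixedPoint_of_bounded_of_innerProductSpace
    (f := fun x => e (f (e.symm x))) (by fun_prop)
    ((e.lipschitz.isBounded_image hbdd).subset (by rintro _ ⟨x, rfl⟩; exact ⟨_, ⟨_, rfl⟩, rfl⟩))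
  exact ⟨e.symm x, e.injective (by simpa using hx)⟩

end FixedPoint

/-! ### Coupled variational inequalities -/

/-- A pair of variational inequalities on compact convex sets, one for a leader and one for each
member of a finite family of followers, has a solution. -/
theorem exists_coupled_variational_solution {ι E F : Type*} [Fintype ι]
    [NormedAddCommGroup E] [InnerProductSpace ℝ E] [FiniteDimensional ℝ E]
    [NormedAddCommGroup F] [InnerProductSpace ℝ F] [FiniteDimensional ℝ F]
    {K : Set E} {L : Set F}
    (hKne : K.Nonempty) (hKcompact : IsCompact K) (hKconvex : Convex ℝ K)
    (hLne : L.Nonempty) (hLcompact : IsCompact L) (hLconvex : Convex ℝ L)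
    {u : E × (ι → F) → E} (hu : ContinuousOn u (K ×ˢ Set.univ.pi fun _ => L))
    {v : ι → E × F → F} (hv : ∀ i, ContinuousOn (v i) (K ×ˢ L)) :
    ∃ x ∈ K, ∃ y : ι → F, (∀ i, y i ∈ L) ∧
      (∀ x' ∈ K, inner ℝ (u (x, y)) (x' - x) ≤ 0) ∧
      ∀ i, ∀ y' ∈ L, inner ℝ (v i (x, y i)) (y' - y i) ≤ 0 := by
  obtain ⟨P, hP⟩ := exists_convex_projection hKne hKcompact.isClosed hKconvex
  obtain ⟨Q, hQ⟩ := exists_convex_projection hLne hLcompact.isClosed hLconvex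
  have hPc : Continuous P := (lipschitzWith_convex_projection hP).continuous
  have hQc : Continuous Q := (lipschitzWith_convex_projection hQ).continuous
  -- The inner projections make `f` continuous on the whole space although `u` and `v` are
  -- controlled only on `K` and `L`; at a fixed point they act as the identity.
  let f : E × (ι → F) → E × (ι → F) := fun z =>
    (P (P z.1 + u (P z.1, fun i => Q (z.2 i))),
      fun i => Q (Q (z.2 i) + v i (P z.1, Q (z.2 i))))
  have hfc : Continuous f := by
    have h1 : Continuous fun z : E × (ι → F) => u (P z.1, fun i => Q (z.2 i)) :=
      hu.comp_continuous (by fun_prop) fun z => ⟨(hP _).1, fun i _ => (hQ _).1⟩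
    have h2 : ∀ i, Continuous fun z : E × (ι → F) => v i (P z.1, Q (z.2 i)) := fun i =>
      (hv i).comp_continuous (by fun_prop) fun z => ⟨(hP _).1, (hQ _).1⟩
    exact (hPc.comp ((hPc.comp continuous_fst).add h1)).prodMk (continuous_pi fun i =>
      hQc.comp ((hQc.comp ((continuous_apply i).comp continuous_snd)).add (h2 i)))
  have hbdd : Bornology.IsBounded (Set.range f) := by
    refine (hKcompact.prod (isCompact_univ_pi fun _ : ι => hLcompact)).isBounded.subset ?_
    rintro _ ⟨z, rfl⟩
    exact ⟨(hP _).1, fun i _ => (hQ _).1⟩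
  obtain ⟨⟨x, y⟩, hxy⟩ := exists_fixedPoint_of_bounded hfc hbdd
  have hx : P (P x + u (P x, fun i => Q (y i))) = x := congrArg Prod.fst hxy
  have hy : ∀ i, Q (Q (y i) + v i (P x, Q (y i))) = y i :=
    fun i => congrFun (congrArg Prod.snd hxy) i
  have hxK : x ∈ K := hx ▸ (hP _).1
  have hyL : ∀ i, y i ∈ L := fun i => hy i ▸ (hQ _).1
  have hQy : ∀ i, Q (y i) = y i := fun i => convex_projection_eq_self hQ (hyL i)
  simp only [convex_projection_eq_self hP hxK, hQy] at hx hy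
  refine ⟨x, hxK, y, hyL, fun x' hx' => ?_, fun i y' hy' => ?_⟩
  · have h := (hP (x + u (x, y))).2 x' hx'
    rwa [hx, add_sub_cancel_left] at h
  · have h := (hQ (y i + v i (x, y i))).2 y' hy'
    rwa [hy i, add_sub_cancel_left] at h

/-! ### Application to the meta-Stackelberg game -/

namespace MetaStackelberg.BSMG

/-- Transfers the continuity assumed type by type to the defender's prior-averaged field. -/
theorem gradient_metaObjective {S AD Ξ : Type*} [Fintype Ξ] {A : Ξ → Type*} {m k : ℕ}
    [MeasurableSpace S] [MeasurableSpace AD] [∀ ξ, MeasurableSpace (A ξ)]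
    (G : BSMG S AD A m k) {θ : EuclideanSpace ℝ (Fin m)} {φ : Ξ → EuclideanSpace ℝ (Fin k)}
    (h : ∀ ξ, DifferentiableAt ℝ (fun ϑ => G.LD ϑ (φ ξ) ξ) θ) :
    gradient (fun ϑ => G.metaObjective ϑ φ) θ =
      ∑ ξ, (G.prior ξ).toReal • gradient (fun ϑ => G.LD ϑ (φ ξ) ξ) θ := by
  refine HasGradientAt.gradient ?_
  rw [hasGradientAt_iff_hasFDerivAt, map_sum]
  simp only [map_smul]
  exact HasFDerivAt.fun_sum fun ξ _ =>
    ((h ξ).hasGradientAt.hasFDerivAt.const_mul (G.prior ξ).toReal)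

end MetaStackelberg.BSMG

theorem mainTheorem2 {S AD Ξ : Type*} [Fintype Ξ] {A : Ξ → Type*} {m k : ℕ}
    [MeasurableSpace S] [MeasurableSpace AD] [∀ ξ, MeasurableSpace (A ξ)]
    (G : MetaStackelberg.BSMG S AD A m k)
    (Θ : Set (EuclideanSpace ℝ (Fin m))) (Φ : Set (EuclideanSpace ℝ (Fin k)))
    (hΘ_nonempty : Θ.Nonempty) (hΘ_compact : IsCompact Θ) (hΘ_convex : Convex ℝ Θ)
    (hΦ_nonempty : Φ.Nonempty) (hΦ_compact : IsCompact Φ) (hΦ_convex : Convex ℝ Φ)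
    (hsmooth : G.IsContinuouslyDifferentiableOn Θ Φ) :
    ∃ (θ : EuclideanSpace ℝ (Fin m)) (φ : Ξ → EuclideanSpace ℝ (Fin k)),
      G.IsMetaFOSE Θ Φ θ φ := by
  have hu : ContinuousOn (fun p : EuclideanSpace ℝ (Fin m) × (Ξ → EuclideanSpace ℝ (Fin k)) =>
      ∑ ξ, (G.prior ξ).toReal • gradient (fun ϑ => G.LD ϑ (p.2 ξ) ξ) p.1)
      (Θ ×ˢ Set.univ.pi fun _ => Φ) := by
    refine continuousOn_finsetSum _ fun ξ _ => ?_
    exact ((hsmooth ξ).2.2.1.comp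
      (f := fun p : EuclideanSpace ℝ (Fin m) × (Ξ → EuclideanSpace ℝ (Fin k)) => (p.1, p.2 ξ))
      (by fun_prop) fun p hp => ⟨hp.1, hp.2 ξ trivial⟩).const_smul (G.prior ξ).toReal
  obtain ⟨θ, hθ, φ, hφ, hD, hA⟩ := exists_coupled_variational_solution
    hΘ_nonempty hΘ_compact hΘ_convex hΦ_nonempty hΦ_compact hΦ_convex hu
    (v := fun ξ p => gradient (fun ψ => G.LA p.1 ψ ξ) p.2) (fun ξ => (hsmooth ξ).2.2.2)
  -- The inequalities hold on all of `Θ` and `Φ`, in particular on the unit balls around the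
  -- solution.
  refine ⟨θ, φ, hθ, hφ, fun θ' hθ' _ => ?_, fun ξ φ' hφ' _ => hA ξ φ' hφ'⟩
  rw [G.gradient_metaObjective fun ξ => (hsmooth ξ).1 θ hθ (φ ξ) (hφ ξ)]
  exact hD θ' hθ'
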